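/- The following is a theorem of Zermelo--Fraenkel set theory $\mathsf{ZF}$ (without the axiom of choice); that is, it holds in every model of $\mathsf{ZF}$. Write $|A|\le|B|$ if there is an injective function $A\to B$, $|A|=|B|$ if there is a bijection $A\to B$, and $|A|<|B|$ if $|A|\le|B|$ and $|A|\ne|B|$. Let $X$ be a Russell set: $X=\bigcup_{n\in\mathbb N}P_n$, where the $P_n$ are pairwise disjoint sets with exactly two elements each, and no infinite subset of the family $\{P_n : n\in\mathbb N\}$ has a choice function. Let $G=(X,E)$ be the graph with vertex set $X$ and edge set $E=\{P_n : n\in\mathbb N\}$. For a set $A$ (of colours), a proper coloring of $G$ with colours in $A$ is a function $c:X\to A$ such that $c(u)\neq c(v)$ whenever $\{u,v\}\in E$. Then $G$ has no well-defined chromatic number: there is no set $A$ such that $G$ has a proper coloring with colours in $A$ and $|A|\le|B|$ for every set $B$ such that $G$ has a proper coloring with colours in $B$. In fact, for every set $A$ and every proper coloring $c:X\to A$ of $G$ there are a set $B$ with $|B|<|A|$ and a proper coloring $d:X\to B$ of $G$. -/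

import Mathlib

namespace ZFModel

universe u

/-- The only non-logical symbol of the language of set theory: a binary relation symbol. -/
inductive MemSymbol : ℕ → Type
  | mem : MemSymbol 2

/-- The first-order language of set theory. -/
def setLang : FirstOrder.Language := ⟨fun _ => Empty, MemSymbol⟩

section

variable {M : Type u} [setLang.Structure M]

/-- The membership relation of a structure for the language of set theory. It has nothing to do
with the metatheoretic membership `∈`. -/
def Mem (x y : M) : Prop :=
  FirstOrder.Language.Structure.RelMap (L := setLang) MemSymbol.mem ![x, y]

infix:50 " ∊ " => Mem

/-! ### Basic set-theoretic notions, interpreted inside the structure -/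

/-- `e = ∅`. -/
def IsEmptySet (e : M) : Prop := ∀ x, ¬ x ∊ e

/-- `a ⊆ b`. -/
def Sub (a b : M) : Prop := ∀ x, x ∊ a → x ∊ b

/-- `z = {x, y}`. -/
def IsUnorderedPair (z x y : M) : Prop := ∀ w, w ∊ z ↔ w = x ∨ w = y

/-- `s = x ∪ {x}`. -/
def IsSucc (s x : M) : Prop := ∀ w, w ∊ s ↔ w ∊ x ∨ w = x

/-- `p = (x, y) = {{x}, {x, y}}`, the Kuratowski pair. -/
def IsOrderedPair (p x y : M) : Prop :=
  ∃ a b, IsUnorderedPair a x x ∧ IsUnorderedPair b x y ∧ IsUnorderedPair p a b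

/-- `∅ ∈ w`, and `w` is closed under `x ↦ x ∪ {x}`. -/
def IsInductive (w : M) : Prop :=
  (∃ e, IsEmptySet e ∧ e ∊ w) ∧ ∀ x, x ∊ w → ∃ s, IsSucc s x ∧ s ∊ w

/-- `w` is the set of natural numbers: the least inductive set. -/
def IsOmega (w : M) : Prop := IsInductive w ∧ ∀ v, IsInductive v → Sub w v

end

/-- The structure `M` is a model of Zermelo-Fraenkel set theory, without the axiom of choice.
Both schemata range over the formulas of the language of set theory with parameters in `M`. -/
structure IsModelZF (M : Type u) [setLang.Structure M] : Prop where
  extensionality : ∀ a b : M, (∀ x, x ∊ a ↔ x ∊ b) → a = b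
  foundation : ∀ a : M, (∃ x, x ∊ a) → ∃ x, x ∊ a ∧ ∀ y, y ∊ x → ¬ y ∊ a
  pairing : ∀ x y : M, ∃ z, IsUnorderedPair z x y
  union : ∀ a : M, ∃ b, ∀ x, x ∊ b ↔ ∃ y, y ∊ a ∧ x ∊ y
  powerset : ∀ a : M, ∃ b, ∀ x, x ∊ b ↔ Sub x a
  infinity : ∃ w : M, IsInductive w
  separation : ∀ S : Set M, (Set.univ : Set M).Definable₁ setLang S →
    ∀ a : M, ∃ b, ∀ x, x ∊ b ↔ x ∊ a ∧ x ∈ S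
  replacement : ∀ R : Set (M × M), (Set.univ : Set M).Definable₂ setLang R →
    ∀ a : M, (∀ x, x ∊ a → ∀ y z, (x, y) ∈ R → (x, z) ∈ R → y = z) →
      ∃ b, ∀ y, y ∊ b ↔ ∃ x, x ∊ a ∧ (x, y) ∈ R

section

variable {M : Type u} [setLang.Structure M]

/-! ### Functions and cardinalities, inside the structure -/

/-- `(x, y) ∈ f`; for a function `f` this says `f(x) = y`. -/
def Maps (f x y : M) : Prop := ∃ p, IsOrderedPair p x y ∧ p ∊ f

/-- `f` is a function from `a` to `b`. -/
def IsFunction (f a b : M) : Prop :=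
  (∀ p, p ∊ f → ∃ x y, x ∊ a ∧ y ∊ b ∧ IsOrderedPair p x y) ∧
    ∀ x, x ∊ a → ∃! y, Maps f x y

/-- `|a| ≤ |b|`: there is an injective function from `a` to `b`. -/
def CardLE (a b : M) : Prop :=
  ∃ f, IsFunction f a b ∧ ∀ x x' y, Maps f x y → Maps f x' y → x = x'

/-- `|a| = |b|`: there is a bijective function from `a` to `b`. -/
def CardEq (a b : M) : Prop :=
  ∃ f, IsFunction f a b ∧ (∀ x x' y, Maps f x y → Maps f x' y → x = x') ∧
    ∀ y, y ∊ b → ∃ x, Maps f x y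

/-- `|a| < |b|`. -/
def CardLT (a b : M) : Prop := CardLE a b ∧ ¬ CardEq a b

/-- `a` is finite: equipotent to a natural number. -/
def IsFinite (a : M) : Prop := ∃ w n, IsOmega w ∧ n ∊ w ∧ CardEq a n

/-- `s`, as a family of sets, has a choice function. -/
def HasChoiceFunction (s : M) : Prop :=
  ∃ f b, IsFunction f s b ∧ ∀ a x, a ∊ s → Maps f a x → x ∊ a

/-! ### Graphs and Russell sets, inside the structure -/

/-- `c : V → A` is a proper colouring, with `A` as set of colours, of the graph with vertex set
`V` and edge set `E` (a set of unordered pairs of vertices). -/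
def IsProperColoring (V E A c : M) : Prop :=
  IsFunction c V A ∧
    ∀ e u v, e ∊ E → IsUnorderedPair e u v → ∀ a b, Maps c u a → Maps c v b → a ≠ b

/-- The graph `(V, E)` has a proper colouring with `A` as set of colours. -/
def Colorable (V E A : M) : Prop := ∃ c, IsProperColoring V E A c

/-- The chromatic number of the graph `(V, E)` is `|A|`: this is the least cardinality of a set of
colours with which the graph has a proper colouring. -/
def IsChromaticNumber (V E A : M) : Prop :=
  Colorable V E A ∧ ∀ B, Colorable V E B → CardLE A B

/-- `X` is a Russell set, as witnessed by the sequence `P = (P_n)` indexed by the natural numbers: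
the `P_n` are pairwise disjoint sets with exactly two elements, their union is `X`, and no infinite
subset of `{P_n | n ∈ ω}` has a choice function. -/
structure IsRussellSet (X P : M) : Prop where
  sequence : ∃ w Q, IsOmega w ∧ IsFunction P w Q
  pair : ∀ n p, Maps P n p → ∃ x y, x ≠ y ∧ IsUnorderedPair p x y
  disjoint : ∀ m n p q, Maps P m p → Maps P n q → m ≠ n → ∀ x, ¬ (x ∊ p ∧ x ∊ q)
  cover : ∀ x, x ∊ X ↔ ∃ n p, Maps P n p ∧ x ∊ p
  no_choice : ∀ S, (∀ p, p ∊ S → ∃ n, Maps P n p) → ¬ IsFinite S → ¬ HasChoiceFunction S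

/-- `E = {P_n | n ∈ ω}` is the set of terms of the sequence `P`. -/
def IsSetOfTerms (E P : M) : Prop := ∀ e, e ∊ E ↔ ∃ n, Maps P n e

end

end ZFModel

namespace ZFModel

open FirstOrder Language

universe u

variable {M : Type u} [setLang.Structure M]

/-! Let `c` be a proper colouring, let `a` be a colour it uses, and let `B` be the set of the other
used colours. `B` still suffices (`exists_coloring_omit_color`): only one pair can be chosen from by
its colour `a` at each edge meeting `a`, so recolour the vertices of colour `a` by `b₁`, their
partners by `b₂`, and leave the rest alone. There is no injection `h : A → B`
(`not_cardLE_of_omit_color`). Otherwise `a, h(a), h(h(a)), ...` are distinct used colours, because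
`a` is not in `B`. Infinitely many edges then carry one of them, since an edge has only two colours;
choosing in each such edge the vertex whose colour comes earliest in the orbit contradicts the
Russell property. Separation is available for definable classes only, so definability is derived by
instance search; the orbit is expressed by closed sets (`Cl`) instead of recursion. -/

/-! ### Definability by instance inference -/

/-- `t` is given by a term (a variable or a parameter). -/
class IsTerm {n : ℕ} (t : (Fin n → M) → M) : Prop where
  out : ∃ s : setLang.Term (M ⊕ Fin n), ∀ v, s.realize (Sum.elim id v) = t v

/-- `p` is definable by a first-order formula with parameters. -/
class Dfn {n : ℕ} (p : (Fin n → M) → Prop) : Prop where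
  out : ∃ φ : setLang.BoundedFormula M n, ∀ v, φ.Realize id v ↔ p v

section Instances

variable {n : ℕ}

instance IsTerm.var (i : Fin n) : IsTerm fun v : Fin n → M => v i :=
  ⟨Term.var (Sum.inr i), fun _ => rfl⟩

instance IsTerm.const (c : M) : IsTerm fun _ : Fin n → M => c :=
  ⟨Term.var (Sum.inl c), fun _ => rfl⟩

instance Dfn.mem (s t : (Fin n → M) → M) [hs : IsTerm s] [ht : IsTerm t] :
    Dfn fun v => s v ∊ t v := by
  obtain ⟨s', hs⟩ := hs.out
  obtain ⟨t', ht⟩ := ht.out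
  refine ⟨(Relations.boundedFormula₂ (show setLang.Relations 2 from MemSymbol.mem) s' t'), fun v => ?_⟩
  exact BoundedFormula.realize_rel₂.trans (by rw [hs, ht]; rfl)

instance Dfn.eq (s t : (Fin n → M) → M) [hs : IsTerm s] [ht : IsTerm t] :
    Dfn fun v => s v = t v := by
  obtain ⟨s', hs⟩ := hs.out
  obtain ⟨t', ht⟩ := ht.out
  exact ⟨s'.bdEqual t', fun v => by rw [BoundedFormula.realize_bdEqual, hs, ht]⟩

instance Dfn.not (p : (Fin n → M) → Prop) [hp : Dfn p] : Dfn fun v => ¬ p v := by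
  obtain ⟨φ, hφ⟩ := hp.out
  exact ⟨φ.not, fun v => by rw [BoundedFormula.realize_not, hφ]⟩

instance Dfn.imp (p q : (Fin n → M) → Prop) [hp : Dfn p] [hq : Dfn q] :
    Dfn fun v => p v → q v := by
  obtain ⟨φ, hφ⟩ := hp.out
  obtain ⟨ψ, hψ⟩ := hq.out
  exact ⟨φ.imp ψ, fun v => by rw [BoundedFormula.realize_imp, hφ, hψ]⟩

instance Dfn.and (p q : (Fin n → M) → Prop) [hp : Dfn p] [hq : Dfn q] :
    Dfn fun v => p v ∧ q v := by
  obtain ⟨φ, hφ⟩ := hp.out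
  obtain ⟨ψ, hψ⟩ := hq.out
  exact ⟨φ ⊓ ψ, fun v => by rw [BoundedFormula.realize_inf, hφ, hψ]⟩

instance Dfn.or (p q : (Fin n → M) → Prop) [hp : Dfn p] [hq : Dfn q] :
    Dfn fun v => p v ∨ q v := by
  obtain ⟨φ, hφ⟩ := hp.out
  obtain ⟨ψ, hψ⟩ := hq.out
  exact ⟨φ ⊔ ψ, fun v => by rw [BoundedFormula.realize_sup, hφ, hψ]⟩

instance Dfn.iff (p q : (Fin n → M) → Prop) [hp : Dfn p] [hq : Dfn q] :
    Dfn fun v => p v ↔ q v := by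
  obtain ⟨φ, hφ⟩ := hp.out
  obtain ⟨ψ, hψ⟩ := hq.out
  exact ⟨φ.iff ψ, fun v => by rw [BoundedFormula.realize_iff, hφ, hψ]⟩

/-- The bound variable becomes the last coordinate of the longer tuple, as in `BoundedFormula.all`.
-/
instance Dfn.all (p : (Fin n → M) → M → Prop)
    [hp : Dfn fun w : Fin (n + 1) → M => p (fun i => w i.castSucc) (w (Fin.last n))] :
    Dfn fun v => ∀ x, p v x := by
  obtain ⟨φ, hφ⟩ := hp.out
  exact ⟨φ.all, fun v => by simp [BoundedFormula.realize_all, hφ]⟩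

instance Dfn.ex (p : (Fin n → M) → M → Prop)
    [hp : Dfn fun w : Fin (n + 1) → M => p (fun i => w i.castSucc) (w (Fin.last n))] :
    Dfn fun v => ∃ x, p v x := by
  obtain ⟨φ, hφ⟩ := hp.out
  exact ⟨φ.ex, fun v => by simp [BoundedFormula.realize_ex, hφ]⟩


/-- Weakening by one variable, needed whenever a term is moved under a quantifier. -/
theorem IsTerm.lift {t : (Fin n → M) → M} (ht : IsTerm t) :
    IsTerm fun w : Fin (n + 1) → M => t fun i => w i.castSucc := by
  obtain ⟨s, hs⟩ := ht.out
  refine ⟨s.relabel (Sum.map id Fin.castSucc), fun v => ?_⟩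
  rw [Term.realize_relabel, ← hs]
  congr 1
  ext x
  cases x <;> rfl

instance Dfn.isUnorderedPair (r s t : (Fin n → M) → M) [hr : IsTerm r] [hs : IsTerm s]
    [ht : IsTerm t] : Dfn fun v => IsUnorderedPair (r v) (s v) (t v) := by
  have := hr.lift
  have := hs.lift
  have := ht.lift
  unfold IsUnorderedPair
  infer_instance

instance Dfn.isOrderedPair (r s t : (Fin n → M) → M) [hr : IsTerm r] [hs : IsTerm s]
    [ht : IsTerm t] : Dfn fun v => IsOrderedPair (r v) (s v) (t v) := by
  have := hr.lift.lift
  have := hs.lift.lift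
  have := ht.lift.lift
  unfold IsOrderedPair
  infer_instance

instance Dfn.maps (r s t : (Fin n → M) → M) [hr : IsTerm r] [hs : IsTerm s]
    [ht : IsTerm t] : Dfn fun v => Maps (r v) (s v) (t v) := by
  have := hr.lift
  have := hs.lift
  have := ht.lift
  unfold Maps
  infer_instance

end Instances

/-! ### Elementary constructions -/

namespace IsModelZF

variable (hM : IsModelZF M)
include hM

theorem exists_sep (p : M → Prop) [hp : Dfn fun v : Fin 1 → M => p (v 0)] (a : M) :
    ∃ b, ∀ x, x ∊ b ↔ x ∊ a ∧ p x := by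
  obtain ⟨φ, hφ⟩ := hp.out
  refine hM.separation {x | p x} ?_ a
  rw [Set.Definable₁, Set.definable_iff_exists_formula_sum]
  refine ⟨φ.toFormula.relabel (Sum.map (fun x => ⟨x, trivial⟩) id), ?_⟩
  ext v
  rw [Set.mem_ofPred_eq, Set.mem_ofPred_eq, Set.mem_ofPred_eq, Formula.realize_relabel,
    BoundedFormula.realize_toFormula]
  exact (hφ v).symm

theorem exists_union (a b : M) : ∃ c, ∀ x, x ∊ c ↔ x ∊ a ∨ x ∊ b := by
  obtain ⟨z, hz⟩ := hM.pairing a b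
  obtain ⟨c, hc⟩ := hM.union z
  refine ⟨c, fun x => (hc x).trans ⟨?_, ?_⟩⟩
  · rintro ⟨y, hy, hx⟩
    rcases (hz y).1 hy with rfl | rfl
    exacts [Or.inl hx, Or.inr hx]
  · rintro (h | h)
    exacts [⟨a, (hz a).2 (Or.inl rfl), h⟩, ⟨b, (hz b).2 (Or.inr rfl), h⟩]

theorem not_mem_self (x : M) : ¬ x ∊ x := by
  intro h
  obtain ⟨z, hz⟩ := hM.pairing x x
  obtain ⟨y, hy, hd⟩ := hM.foundation z ⟨x, (hz x).2 (Or.inl rfl)⟩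
  obtain rfl : y = x := by simpa using (hz y).1 hy
  exact hd y h hy

theorem unorderedPair_unique {z z' x y : M} (h : IsUnorderedPair z x y)
    (h' : IsUnorderedPair z' x y) : z = z' :=
  hM.extensionality _ _ fun w => (h w).trans (h' w).symm

theorem exists_orderedPair (x y : M) : ∃ p, IsOrderedPair p x y := by
  obtain ⟨a, ha⟩ := hM.pairing x x
  obtain ⟨b, hb⟩ := hM.pairing x y
  obtain ⟨p, hp⟩ := hM.pairing a b
  exact ⟨p, a, b, ha, hb, hp⟩

theorem orderedPair_unique {p p' x y : M} (h : IsOrderedPair p x y) (h' : IsOrderedPair p' x y) :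
    p = p' := by
  obtain ⟨a, b, ha, hb, hp⟩ := h
  obtain ⟨a', b', ha', hb', hp'⟩ := h'
  obtain rfl := hM.unorderedPair_unique ha ha'
  obtain rfl := hM.unorderedPair_unique hb hb'
  exact hM.unorderedPair_unique hp hp'

omit hM in
theorem orderedPair_inj {p x y x' y' : M} (h : IsOrderedPair p x y)
    (h' : IsOrderedPair p x' y') : x = x' ∧ y = y' := by
  obtain ⟨a, b, ha, hb, hp⟩ := h
  obtain ⟨a', b', ha', hb', hp'⟩ := h'
  have hxa := (ha x).2 (Or.inl rfl)
  have hxb := (hb x).2 (Or.inl rfl)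
  have hyb := (hb y).2 (Or.inr rfl)
  have hxa' := (ha' x').2 (Or.inl rfl)
  have hxb' := (hb' x').2 (Or.inl rfl)
  have hyb' := (hb' y').2 (Or.inr rfl)
  have h1 := (hp a).2 (Or.inl rfl)
  have h2 := (hp b).2 (Or.inr rfl)
  have h3 := (hp' a').2 (Or.inl rfl)
  have h4 := (hp' b').2 (Or.inr rfl)
  rw [hp'] at h1 h2
  rw [hp] at h3 h4
  have hx : x = x' := by
    rcases h3 with rfl | rfl
    · simpa using (ha' x).1 hxa
    · simpa using (ha' x).1 hxb
  subst hx
  refine ⟨rfl, ?_⟩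
  rcases h2 with rfl | rfl
  · obtain rfl : y = x := by simpa using (ha' y).1 hyb
    rcases h4 with rfl | rfl
    · exact (or_self_iff.1 ((ha _).1 hyb')).symm
    · exact (or_self_iff.1 ((hb _).1 hyb')).symm
  · rcases (hb' y).1 hyb with rfl | rfl
    · exact (or_self_iff.1 ((hb _).1 hyb')).symm
    · rfl

theorem exists_function (R : M → M → Prop) [Dfn fun v : Fin 3 → M => R (v 1) (v 2)]
    (a b : M) (hR : ∀ x, x ∊ a → ∃! y, y ∊ b ∧ R x y) :
    ∃ f, IsFunction f a b ∧ ∀ x y, Maps f x y ↔ x ∊ a ∧ y ∊ b ∧ R x y := by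
  obtain ⟨c, hc⟩ := hM.exists_union a b
  obtain ⟨q, hq⟩ := hM.powerset c
  obtain ⟨r, hr⟩ := hM.powerset q
  have : Dfn fun v : Fin 1 → M =>
      ∃ x y, x ∊ a ∧ y ∊ b ∧ R x y ∧ IsOrderedPair (v 0) x y := by
    have : Dfn fun w : Fin 3 → M => R (w (Fin.castSucc (Fin.last 1))) (w (Fin.last 2)) := ‹_›
    infer_instance
  -- Kuratowski pairs of elements of `a ∪ b` lie in its double power set `r`.
  obtain ⟨f, hf⟩ := hM.exists_sep
    (fun p => ∃ x y, x ∊ a ∧ y ∊ b ∧ R x y ∧ IsOrderedPair p x y) r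
  have key : ∀ x y, Maps f x y ↔ x ∊ a ∧ y ∊ b ∧ R x y := by
    intro x y
    constructor
    · rintro ⟨p, hp, hpf⟩
      obtain ⟨-, x', y', hx, hy, h, hp'⟩ := (hf p).1 hpf
      obtain ⟨rfl, rfl⟩ := orderedPair_inj hp hp'
      exact ⟨hx, hy, h⟩
    · rintro ⟨hx, hy, h⟩
      obtain ⟨p, hp⟩ := hM.exists_orderedPair x y
      refine ⟨p, hp, (hf p).2 ⟨?_, x, y, hx, hy, h, hp⟩⟩
      obtain ⟨s, t, hs, ht, hp⟩ := hp
      refine (hr p).2 fun z hz => (hq z).2 fun w hw => (hc w).2 ?_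
      rcases (hp z).1 hz with rfl | rfl
      · rcases (hs w).1 hw with rfl | rfl <;> exact Or.inl hx
      · rcases (ht w).1 hw with rfl | rfl
        exacts [Or.inl hx, Or.inr hy]
  refine ⟨f, ⟨fun p hp => ?_, fun x hx => ?_⟩, key⟩
  · obtain ⟨-, x, y, hx, hy, -, h⟩ := (hf p).1 hp
    exact ⟨x, y, hx, hy, h⟩
  · obtain ⟨y, hy, hu⟩ := hR x hx
    exact ⟨y, (key x y).2 ⟨hx, hy⟩, fun z hz => hu z ((key x z).1 hz).2⟩

/-! ### Induction on natural numbers and on finite sets. -/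

theorem omega_induction (p : M → Prop) [Dfn fun v : Fin 1 → M => p (v 0)] {w : M}
    (hw : IsOmega w) (zero : ∀ e, IsEmptySet e → p e)
    (succ : ∀ x s, x ∊ w → IsSucc s x → p x → p s) {n : M} (hn : n ∊ w) : p n := by
  obtain ⟨v, hv⟩ := hM.exists_sep p w
  refine ((hv n).1 (hw.2 v ⟨?_, fun x hx => ?_⟩ n hn)).2
  · obtain ⟨e, he, hew⟩ := hw.1.1
    exact ⟨e, he, (hv e).2 ⟨hew, zero e he⟩⟩
  · obtain ⟨hxw, hpx⟩ := (hv x).1 hx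
    obtain ⟨s, hs, hsw⟩ := hw.1.2 x hxw
    exact ⟨s, hs, (hv s).2 ⟨hsw, succ x s hxw hs hpx⟩⟩

theorem mem_trans_of_mem_omega {w n : M} (hw : IsOmega w) (hn : n ∊ w) :
    ∀ x y, x ∊ y → y ∊ n → x ∊ n := by
  refine hM.omega_induction (fun n => ∀ x y, x ∊ y → y ∊ n → x ∊ n) hw ?_ ?_ hn
  · intro e he x y _ hy
    exact (he y hy).elim
  · intro n s _ hs ih x y hxy hy
    rcases (hs y).1 hy with h | rfl
    · exact (hs x).2 (Or.inl (ih x y hxy h))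
    · exact (hs x).2 (Or.inl hxy)

theorem finite_induction (p : M → Prop)
    (hp : ∀ n (t : (Fin n → M) → M) [IsTerm t], Dfn fun v => p (t v)) {S : M}
    (hS : IsFinite S) (empty : ∀ e, IsEmptySet e → p e)
    (insert : ∀ y z x, x ∊ S → (∀ u, u ∊ z ↔ u ∊ y ∨ u = x) → p y → p z) : p S := by
  obtain ⟨w, n, hw, hn, f, hf, hinj, -⟩ := hS
  -- Induct on `k` over the preimage of `k` in `S`; by injectivity, each step adds at most one
  -- element.
  have key := hM.omega_induction
    (fun k => ∀ y, (∀ x, x ∊ y ↔ x ∊ S ∧ ∃ i, i ∊ k ∧ Maps f x i) → p y) hw ?_ ?_ hn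
  · refine key S fun x => ⟨fun hx => ⟨hx, ?_⟩, fun h => h.1⟩
    obtain ⟨i, ⟨q, hq, hqf⟩, -⟩ := hf.2 x hx
    obtain ⟨x', i', -, hi, hq'⟩ := hf.1 q hqf
    obtain ⟨rfl, rfl⟩ := orderedPair_inj hq hq'
    exact ⟨i, hi, q, hq, hqf⟩
  · intro e he y hy
    exact empty y fun x hx => by
      obtain ⟨-, i, hi, -⟩ := (hy x).1 hx
      exact he i hi
  · intro k s _ hs ih z hz
    obtain ⟨y, hy⟩ := hM.exists_sep (fun x => ∃ i, i ∊ k ∧ Maps f x i) S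
    have hpy := ih y hy
    by_cases hx : ∃ x, x ∊ S ∧ Maps f x k
    · obtain ⟨x, hxS, hx⟩ := hx
      refine insert y z x hxS (fun u => ?_) hpy
      rw [hz, hy]
      constructor
      · rintro ⟨hu, i, hi, hm⟩
        rcases (hs i).1 hi with h | rfl
        · exact Or.inl ⟨hu, i, h, hm⟩
        · exact Or.inr (hinj _ _ _ hm hx)
      · rintro (⟨hu, i, hi, hm⟩ | rfl)
        · exact ⟨hu, i, (hs i).2 (Or.inl hi), hm⟩
        · exact ⟨hxS, k, (hs k).2 (Or.inr rfl), hx⟩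
    · convert hpy
      refine hM.extensionality _ _ fun u => ?_
      rw [hz, hy]
      constructor
      · rintro ⟨hu, i, hi, hm⟩
        rcases (hs i).1 hi with h | rfl
        · exact ⟨hu, i, h, hm⟩
        · exact (hx ⟨u, hu, hm⟩).elim
      · rintro ⟨hu, i, hi, hm⟩
        exact ⟨hu, i, (hs i).2 (Or.inl hi), hm⟩

/-- Let `W` be a nonempty preordered class in which every point has, for each `a`, a successor that
is not below `a`. If every point is related to an element of `S`, and each element of `S` is related
to at most two points, then `S` is infinite. -/
theorem not_isFinite_of_cover (W : M → Prop) (le R : M → M → Prop)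
    (hW : ∀ n (t : (Fin n → M) → M) [IsTerm t], Dfn fun v => W (t v))
    (hle : ∀ n (s t : (Fin n → M) → M) [IsTerm s] [IsTerm t], Dfn fun v => le (s v) (t v))
    (hR : ∀ n (s t : (Fin n → M) → M) [IsTerm s] [IsTerm t], Dfn fun v => R (s v) (t v))
    {x₀ : M} (hx₀ : W x₀) (le_refl : ∀ x, le x x)
    (le_trans : ∀ x y z, W z → le x y → le y z → le x z)
    (step : ∀ x a, W x → ∃ y, W y ∧ le x y ∧ (W a → ¬ le y a)) {S : M}
    (two : ∀ s, s ∊ S → ∃ a b, ∀ y, W y → R y s → y = a ∨ y = b)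
    (cover : ∀ x, W x → ∃ s, s ∊ S ∧ R x s) : ¬ IsFinite S := by
  intro hS
  have : ∀ n (t : (Fin n → M) → M) [IsTerm t], Dfn fun v =>
      ∃ x, W x ∧ ∀ y, W y → le x y → ∀ s, s ∊ t v → ¬ R y s := by
    intro n t ht
    have := ht.lift.lift.lift
    infer_instance
  -- A finite set is avoided by all points above some `x`; for `S` itself this contradicts `cover`.
  obtain ⟨x, hx, h⟩ := hM.finite_induction
    (fun T => ∃ x, W x ∧ ∀ y, W y → le x y → ∀ s, s ∊ T → ¬ R y s) this hS
    (fun e he => ⟨x₀, hx₀, fun _ _ _ s hs => (he s hs).elim⟩) (by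
      rintro T T' s hs hT' ⟨x, hx, h⟩
      obtain ⟨a, b, hab⟩ := two s hs
      -- Climb twice, to get past both points related to `s`.
      obtain ⟨x₁, hx₁, hl₁, ha⟩ := step x a hx
      obtain ⟨x₂, hx₂, hl₂, hb⟩ := step x₁ b hx₁
      refine ⟨x₂, hx₂, fun y hy hl s' hs' hys => ?_⟩
      have hl' := le_trans _ _ _ hy hl₂ hl
      rcases (hT' s').1 hs' with hs' | rfl
      · exact h y hy (le_trans _ _ _ hy hl₁ hl') s' hs' hys
      · rcases hab y hy hys with rfl | rfl
        exacts [ha hy hl', hb hy hl])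
  obtain ⟨s, hs, hxs⟩ := cover x hx
  exact h x hx (le_refl x) s hs hxs

end IsModelZF

/-! ### Closure of a point under a function -/

/-- `y` lies in every set that contains `x` and is closed under `h`. -/
def Cl (h x y : M) : Prop :=
  ∀ Y, x ∊ Y → (∀ u v, u ∊ Y → Maps h u v → v ∊ Y) → y ∊ Y

instance Dfn.cl {n : ℕ} (r s t : (Fin n → M) → M) [hr : IsTerm r] [hs : IsTerm s]
    [ht : IsTerm t] : Dfn fun v => Cl (r v) (s v) (t v) := by
  have := hr.lift.lift.lift
  have := hs.lift
  have := ht.lift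
  unfold Cl
  infer_instance

theorem Cl.refl (h x : M) : Cl h x x := fun _ hx _ => hx

theorem Cl.trans {h x y z : M} (hxy : Cl h x y) (hyz : Cl h y z) : Cl h x z :=
  fun Y hx hY => hyz Y (hxy Y hx hY) hY

theorem Cl.of_maps {h x y : M} (hxy : Maps h x y) : Cl h x y :=
  fun _ hx hY => hY _ _ hx hxy

theorem IsFunction.mem_of_maps {f a b x y : M} (hf : IsFunction f a b) (h : Maps f x y) :
    x ∊ a ∧ y ∊ b := by
  obtain ⟨p, hp, hpf⟩ := h
  obtain ⟨x', y', hx, hy, hp'⟩ := hf.1 p hpf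
  obtain ⟨rfl, rfl⟩ := IsModelZF.orderedPair_inj hp hp'
  exact ⟨hx, hy⟩

theorem IsFunction.unique {f a b x y z : M} (hf : IsFunction f a b) (hy : Maps f x y)
    (hz : Maps f x z) : y = z :=
  (hf.2 x (hf.mem_of_maps hy).1).unique hy hz

section Closure

variable (hM : IsModelZF M) {A B h : M} (hh : IsFunction h A B) (hBA : Sub B A)
include hM hh hBA

theorem Cl.induction (p : M → Prop) [Dfn fun v : Fin 1 → M => p (v 0)] {x y : M}
    (hxA : x ∊ A) (hx : p x) (step : ∀ u v, p u → Maps h u v → p v) (hxy : Cl h x y) : p y := by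
  obtain ⟨Y, hY⟩ := hM.exists_sep p A
  refine ((hY y).1 (hxy Y ((hY x).2 ⟨hxA, hx⟩) fun u v hu huv => (hY v).2 ⟨?_, ?_⟩)).2
  · exact hBA _ (hh.mem_of_maps huv).2
  · exact step u v ((hY u).1 hu).2 huv

omit hM in
theorem Cl.mem {x y : M} (hxA : x ∊ A) (hxy : Cl h x y) : y ∊ A :=
  hxy A hxA fun _ _ _ huv => hBA _ (hh.mem_of_maps huv).2

theorem Cl.eq_or_of_maps {x x' y : M} (hxx' : Maps h x x') (hxy : Cl h x y) :
    y = x ∨ Cl h x' y := by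
  refine Cl.induction hM hh hBA (fun y => y = x ∨ Cl h x' y) (hh.mem_of_maps hxx').1
    (Or.inl rfl) ?_ hxy
  rintro u v (rfl | hu) huv
  · obtain rfl := hh.unique hxx' huv
    exact Or.inr (Cl.refl _ _)
  · exact Or.inr (hu.trans (Cl.of_maps huv))

theorem Cl.total {a x y : M} (ha : a ∊ A) (hx : Cl h a x) (hy : Cl h a y) :
    Cl h x y ∨ Cl h y x := by
  refine Cl.induction hM hh hBA (fun y => Cl h x y ∨ Cl h y x) ha (Or.inr hx) ?_ hy
  rintro u v (hu | hu) huv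
  · exact Or.inl (hu.trans (Cl.of_maps huv))
  · rcases Cl.eq_or_of_maps hM hh hBA huv hu with rfl | h'
    · exact Or.inl (Cl.of_maps huv)
    · exact Or.inr h'

variable (hinj : ∀ x x' y, Maps h x y → Maps h x' y → x = x') {a : M} (ha : a ∊ A)
  (haB : ¬ a ∊ B)
include hinj ha haB

omit ha haB in
-- Every point reachable from `x'` is the image of a point reachable from `x`; injectivity
-- identifies the latter with `y`.
theorem Cl.of_maps_maps {x y x' y' : M} (hx : Maps h x x') (hy : Maps h y y')
    (hxy : Cl h x' y') : Cl h x y := by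
  obtain ⟨z, hz, hxz⟩ : ∃ z, Maps h z y' ∧ Cl h x z := by
    refine Cl.induction hM hh hBA (fun w => ∃ z, Maps h z w ∧ Cl h x z)
      (hBA _ (hh.mem_of_maps hx).2) ⟨x, hx, Cl.refl _ _⟩ ?_ hxy
    rintro u v ⟨z, hz, hxz⟩ huv
    exact ⟨u, huv, hxz.trans (Cl.of_maps hz)⟩
  obtain rfl := hinj _ _ _ hz hy
  exact hxz

/-- No path returns to `a`, because `B` is closed under `h` and omits `a`. A cycle further along the
orbit pulls back by injectivity. -/
theorem Cl.acyclic {x : M} (hx : Cl h a x) : ∀ x', Maps h x x' → ¬ Cl h x' x := by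
  refine Cl.induction hM hh hBA (fun x => ∀ x', Maps h x x' → ¬ Cl h x' x) ha ?_ ?_ hx
  · intro a' ha' hc
    exact haB (hc B (hh.mem_of_maps ha').2 fun _ _ _ huv => (hh.mem_of_maps huv).2)
  · intro u v hu huv v' hvv' hc
    exact hu v huv (Cl.of_maps_maps hM hh hBA hinj hvv' huv hc)

theorem Cl.antisymm {x y : M} (hx : Cl h a x) (hxy : Cl h x y) (hyx : Cl h y x) : x = y := by
  obtain ⟨x', hx', -⟩ := hh.2 x (Cl.mem hh hBA ha hx)
  rcases Cl.eq_or_of_maps hM hh hBA hx' hxy with rfl | h'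
  · rfl
  · exact (Cl.acyclic hM hh hBA hinj ha haB hx x' hx' (h'.trans hyx)).elim

end Closure

/-! ### Russell sets -/

namespace IsRussellSet

variable (hM : IsModelZF M) {X P E : M} (hX : IsRussellSet X P) (hE : IsSetOfTerms E P)
include hX hE

theorem mem_iff (x : M) : x ∊ X ↔ ∃ e, e ∊ E ∧ x ∊ e := by
  rw [hX.cover]
  constructor
  · rintro ⟨n, p, hp, hx⟩
    exact ⟨p, (hE p).2 ⟨n, hp⟩, hx⟩
  · rintro ⟨e, he, hx⟩
    obtain ⟨n, hn⟩ := (hE e).1 he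
    exact ⟨n, e, hn, hx⟩

theorem edge_unique {e e' x : M} (he : e ∊ E) (he' : e' ∊ E) (hx : x ∊ e) (hx' : x ∊ e') :
    e = e' := by
  obtain ⟨n, hn⟩ := (hE e).1 he
  obtain ⟨m, hm⟩ := (hE e').1 he'
  obtain ⟨w, Q, -, hP⟩ := hX.sequence
  by_cases h : n = m
  · subst h
    exact hP.unique hn hm
  · exact (hX.disjoint n m e e' hn hm h x ⟨hx, hx'⟩).elim

theorem exists_edge_eq {e : M} (he : e ∊ E) : ∃ u v, u ≠ v ∧ IsUnorderedPair e u v := by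
  obtain ⟨n, hn⟩ := (hE e).1 he
  exact hX.pair n e hn

theorem isUnorderedPair_of_mem {e u v : M} (he : e ∊ E) (hu : u ∊ e) (hv : v ∊ e)
    (huv : u ≠ v) : IsUnorderedPair e u v := by
  obtain ⟨x, y, -, hxy⟩ := hX.exists_edge_eq hE he
  intro w
  rw [hxy] at *
  grind

include hM

theorem not_isFinite_edges : ¬ IsFinite E := by
  obtain ⟨w, Q, hw, hP⟩ := hX.sequence
  obtain ⟨e, -, hew⟩ := hw.1.1
  -- Disjointness makes the index of each pair unique, so the bound of two points is met with room
  -- to spare.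
  refine hM.not_isFinite_of_cover (· ∊ w) (fun n m => n = m ∨ n ∊ m) (fun n p => Maps P n p)
    (fun _ _ _ => inferInstance)
    (fun _ _ _ _ _ => inferInstance) (fun _ _ _ _ _ => inferInstance)
    hew (fun x => Or.inl rfl) ?_ ?_ ?_ ?_
  · rintro x y z hz (rfl | hxy) (rfl | hyz)
    · exact Or.inl rfl
    · exact Or.inr hyz
    · exact Or.inr hxy
    · exact Or.inr (hM.mem_trans_of_mem_omega hw hz x y hxy hyz)
  · intro x a hx
    by_cases h : a ∊ w ∧ (x = a ∨ x ∊ a)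
    · obtain ⟨ha, hxa⟩ := h
      obtain ⟨s, hs, hsw⟩ := hw.1.2 a ha
      have has : a ∊ s := (hs a).2 (Or.inr rfl)
      refine ⟨s, hsw, Or.inr ((hs x).2 hxa.symm), ?_⟩
      rintro - (rfl | h)
      · exact hM.not_mem_self _ has
      · exact hM.not_mem_self _ (hM.mem_trans_of_mem_omega hw ha a s has h)
    · exact ⟨x, hx, Or.inl rfl, fun ha h' => h ⟨ha, h'⟩⟩
  · intro p hp
    obtain ⟨n, hn⟩ := (hE p).1 hp
    refine ⟨n, n, fun m _ hm => Or.inl ?_⟩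
    by_contra hmn
    obtain ⟨x, y, -, hxy⟩ := hX.exists_edge_eq hE hp
    have hx := (hxy x).2 (Or.inl rfl)
    exact hX.disjoint m n p p hm hn hmn x ⟨hx, hx⟩
  · intro n hn
    obtain ⟨p, hp, -⟩ := hP.2 n hn
    exact ⟨p, (hE p).2 ⟨n, hp⟩, hp⟩

theorem isFinite_of_choice {S : M} (hS : Sub S E) (R : M → M → Prop)
    [Dfn fun v : Fin 3 → M => R (v 1) (v 2)] (hR : ∀ e, e ∊ S → ∃! u, u ∊ e ∧ R e u) :
    IsFinite S := by
  by_contra hfin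
  refine hX.no_choice S (fun p hp => (hE p).1 (hS p hp)) hfin ?_
  obtain ⟨f, hf, hfR⟩ := hM.exists_function (fun e u => u ∊ e ∧ R e u) S X (by
    intro e he
    obtain ⟨u, hu, huniq⟩ := hR e he
    exact ⟨u, ⟨(hX.mem_iff hE u).2 ⟨e, hS e he, hu.1⟩, hu⟩, fun v hv => huniq v hv.2⟩)
  exact ⟨f, X, hf, fun e u _ h => ((hfR e u).1 h).2.2.1⟩

omit hM

/-! ### Proper colourings of the graph of a Russell set. -/

section Coloring

variable {A c : M} (hc : IsProperColoring X E A c)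
include hc

theorem color_injOn {e u v a : M} (he : e ∊ E) (hu : u ∊ e) (hv : v ∊ e) (hua : Maps c u a)
    (hva : Maps c v a) : u = v := by
  by_contra huv
  exact hc.2 e u v he (hX.isUnorderedPair_of_mem hE he hu hv huv) a a hua hva rfl

theorem exists_color {e u : M} (he : e ∊ E) (hu : u ∊ e) : ∃ a, Maps c u a :=
  (hc.1.2 u ((hX.mem_iff hE u).2 ⟨e, he, hu⟩)).exists

include hM

/-- With no colours besides `a` and `b`, every edge would have exactly one vertex of colour `a`,
which gives a choice function on all of `E`. -/
theorem exists_color_ne_ne (a b : M) : ∃ x, (∃ u, Maps c u x) ∧ x ≠ a ∧ x ≠ b := by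
  by_contra! hcon
  refine hX.not_isFinite_edges hM hE
    (hX.isFinite_of_choice hM hE (fun _ h => h) (fun _ u => Maps c u a) fun e he => ?_)
  obtain ⟨u, v, huv, he'⟩ := hX.exists_edge_eq hE he
  have hu := (he' u).2 (Or.inl rfl)
  have hv := (he' v).2 (Or.inr rfl)
  obtain ⟨x, hx⟩ := hX.exists_color hE hc he hu
  obtain ⟨y, hy⟩ := hX.exists_color hE hc he hv
  have hxy := hc.2 e u v he he' x y hx hy
  by_cases hxa : x = a
  · exact ⟨u, ⟨hu, hxa ▸ hx⟩, fun z hz => hX.color_injOn hE hc he hz.1 hu hz.2 (hxa ▸ hx)⟩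
  · have hxb := hcon x ⟨u, hx⟩ hxa
    have hya : y = a := by
      by_contra hya
      exact hxy (hxb.trans (hcon y ⟨v, hy⟩ hya).symm)
    exact ⟨v, ⟨hv, hya ▸ hy⟩, fun z hz => hX.color_injOn hE hc he hz.1 hv hz.2 (hya ▸ hy)⟩

/-- No injection maps the colours into the used colours other than a given used colour. -/
theorem not_cardLE_of_omit_color {B a : M} (ha : ∃ u, Maps c u a)
    (hB : ∀ x, x ∊ B ↔ x ∊ A ∧ x ≠ a ∧ ∃ u, Maps c u x) : ¬ CardLE A B := by
  rintro ⟨h, hh, hinj⟩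
  have hBA : Sub B A := fun x hx => ((hB x).1 hx).1
  have haB : ¬ a ∊ B := fun hx => ((hB a).1 hx).2.1 rfl
  obtain ⟨u₀, hu₀⟩ := ha
  have haA := (hc.1.mem_of_maps hu₀).2
  -- The edges that meet a colour in the orbit of `a`.
  obtain ⟨S, hS⟩ := hM.exists_sep (fun e => ∃ u x, u ∊ e ∧ Maps c u x ∧ Cl h a x) E
  refine hM.not_isFinite_of_cover (S := S) (Cl h a) (Cl h) (fun y e => ∃ u, u ∊ e ∧ Maps c u y)
    (fun _ _ _ => inferInstance)
    (fun _ _ _ _ _ => inferInstance) (fun _ s t hs ht => ?_)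
    (Cl.refl h a) (Cl.refl h) (fun x y z _ => Cl.trans) ?_ ?_ ?_ ?_
  · have := hs.lift
    have := ht.lift
    infer_instance
  · intro x b hx
    by_cases hxb : Cl h x b ∧ Cl h a b
    · obtain ⟨y, hy, -⟩ := hh.2 b (Cl.mem hh hBA haA hxb.2)
      have hby := Cl.of_maps hy
      exact ⟨y, hxb.2.trans hby, hxb.1.trans hby,
        fun hb => Cl.acyclic hM hh hBA hinj haA haB hb y hy⟩
    · exact ⟨x, hx, Cl.refl h x, fun hb h' => hxb ⟨h', hb⟩⟩
  · intro e he
    have heE := ((hS e).1 he).1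
    obtain ⟨u, v, -, he'⟩ := hX.exists_edge_eq hE heE
    obtain ⟨x, hx⟩ := hX.exists_color hE hc heE ((he' u).2 (Or.inl rfl))
    obtain ⟨y, hy⟩ := hX.exists_color hE hc heE ((he' v).2 (Or.inr rfl))
    refine ⟨x, y, ?_⟩
    rintro z - ⟨t, ht, htz⟩
    rcases (he' t).1 ht with rfl | rfl
    exacts [Or.inl (hc.1.unique htz hx), Or.inr (hc.1.unique htz hy)]
  · intro x hx
    obtain ⟨u, hu⟩ : ∃ u, Maps c u x := by
      refine Cl.induction hM hh hBA (fun x => ∃ u, Maps c u x) haA ⟨u₀, hu₀⟩ ?_ hx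
      exact fun y z _ hyz => ((hB z).1 (hh.mem_of_maps hyz).2).2.2
    obtain ⟨e, he, hue⟩ := (hX.mem_iff hE u).1 (hc.1.mem_of_maps hu).1
    exact ⟨e, (hS e).2 ⟨he, u, x, hue, hu, hx⟩, u, hue, hu⟩
  -- Choose the vertex whose colour comes first in the orbit: `Cl.total` gives existence,
  -- `Cl.antisymm` uniqueness.
  · refine hX.isFinite_of_choice hM hE (fun e he => ((hS e).1 he).1)
      (fun e u => ∃ x, Maps c u x ∧ Cl h a x ∧
        ∀ v y, v ∊ e → Maps c v y → Cl h a y → Cl h x y) fun e he => ?_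
    obtain ⟨heE, u, x, hue, hux, hax⟩ := (hS e).1 he
    refine existsUnique_of_exists_of_unique ?_ ?_
    · by_cases hmin : ∀ v y, v ∊ e → Maps c v y → Cl h a y → Cl h x y
      · exact ⟨u, hue, x, hux, hax, hmin⟩
      · push Not at hmin
        obtain ⟨v, y, hve, hvy, hay, hxy⟩ := hmin
        have hyx := (Cl.total hM hh hBA haA hax hay).resolve_left hxy
        have huv : u ≠ v := by
          rintro rfl
          exact hxy (hc.1.unique hux hvy ▸ Cl.refl h x)
        refine ⟨v, hve, y, hvy, hay, fun t z ht htz _ => ?_⟩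
        rcases (hX.isUnorderedPair_of_mem hE heE hue hve huv t).1 ht with rfl | rfl
        · exact hc.1.unique hux htz ▸ hyx
        · exact hc.1.unique hvy htz ▸ Cl.refl h y
    · rintro v v' ⟨hv, y, hvy, hay, hmin⟩ ⟨hv', y', hvy', hay', hmin'⟩
      obtain rfl := Cl.antisymm hM hh hBA hinj haA haB hay (hmin v' y' hv' hvy' hay')
        (hmin' v y hv hvy hay)
      exact hX.color_injOn hE hc heE hv hv' hvy hvy'

theorem exists_coloring_omit_color {B a : M}
    (hB : ∀ x, x ∊ B ↔ x ∊ A ∧ x ≠ a ∧ ∃ u, Maps c u x) : ∃ d, IsProperColoring X E B d := by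
  obtain ⟨b₁, ⟨u₁, hu₁⟩, hb₁, -⟩ := hX.exists_color_ne_ne hM hE hc a a
  obtain ⟨b₂, ⟨u₂, hu₂⟩, hb₂, hb₂₁⟩ := hX.exists_color_ne_ne hM hE hc a b₁
  have hB₁ : b₁ ∊ B := (hB b₁).2 ⟨(hc.1.mem_of_maps hu₁).2, hb₁, u₁, hu₁⟩
  have hB₂ : b₂ ∊ B := (hB b₂).2 ⟨(hc.1.mem_of_maps hu₂).2, hb₂, u₂, hu₂⟩
  obtain ⟨d, hd, hdR⟩ := hM.exists_function (fun u b =>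
    (Maps c u a ∧ b = b₁) ∨ (¬ Maps c u a ∧
      (((∃ e v, e ∊ E ∧ u ∊ e ∧ v ∊ e ∧ Maps c v a) ∧ b = b₂) ∨
        (¬ (∃ e v, e ∊ E ∧ u ∊ e ∧ v ∊ e ∧ Maps c v a) ∧ Maps c u b)))) X B (by
    intro u hu
    by_cases h₁ : Maps c u a
    · exact ⟨b₁, ⟨hB₁, Or.inl ⟨h₁, rfl⟩⟩, by rintro y ⟨-, hy⟩; tauto⟩
    by_cases h₂ : ∃ e v, e ∊ E ∧ u ∊ e ∧ v ∊ e ∧ Maps c v a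
    · refine ⟨b₂, ⟨hB₂, Or.inr ⟨h₁, Or.inl ⟨h₂, rfl⟩⟩⟩, ?_⟩
      rintro y ⟨-, hy⟩
      exact ((hy.resolve_left fun h => h₁ h.1).2.resolve_right fun h => h.1 h₂).2
    obtain ⟨b, hb, hbu⟩ := hc.1.2 u hu
    refine ⟨b, ⟨(hB b).2 ⟨(hc.1.mem_of_maps hb).2, ?_, u, hb⟩, Or.inr ⟨h₁, Or.inr ⟨h₂, hb⟩⟩⟩, ?_⟩
    · rintro rfl
      exact h₁ hb
    · rintro y ⟨-, hy⟩
      exact hbu y ((hy.resolve_left fun h => h₁ h.1).2.resolve_left fun h => h₂ h.1).2)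
  refine ⟨d, hd, ?_⟩
  rintro e u v he huv x y hux hvy rfl
  have hue := (huv u).2 (Or.inl rfl)
  have hve := (huv v).2 (Or.inr rfl)
  have hne : ∀ z, Maps c u z → Maps c v z → False :=
    fun z hu hv => hc.2 e u v he huv z z hu hv rfl
  -- As edges are disjoint, whether a vertex is recoloured depends only on its edge.
  have hpart : ∀ t, t ∊ e → ((∃ e v, e ∊ E ∧ t ∊ e ∧ v ∊ e ∧ Maps c v a) ↔
      Maps c u a ∨ Maps c v a) := by
    intro t ht
    constructor
    · rintro ⟨e', s, he', ht', hs, hsa⟩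
      obtain rfl := hX.edge_unique hE he he' ht ht'
      rcases (huv s).1 hs with rfl | rfl
      exacts [Or.inl hsa, Or.inr hsa]
    · rintro (h | h)
      exacts [⟨e, u, he, ht, hue, h⟩, ⟨e, v, he, ht, hve, h⟩]
  have hu := ((hdR u x).1 hux).2.2
  have hv := ((hdR v x).1 hvy).2.2
  rw [hpart u hue] at hu
  rw [hpart v hve] at hv
  have hu' := hne a
  have hx' := hne x
  by_cases hua : Maps c u a
  · have h₁ : x = b₁ := by tauto
    have h₂ : x = b₂ := by tauto
    exact hb₂₁ (h₂.symm.trans h₁)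
  by_cases hva : Maps c v a
  · have h₁ : x = b₁ := by tauto
    have h₂ : x = b₂ := by tauto
    exact hb₂₁ (h₂.symm.trans h₁)
  tauto

theorem exists_smaller_coloring :
    ∃ B d, IsProperColoring X E B d ∧ Sub B A ∧ ¬ CardLE A B := by
  -- Any used colour will do; the two arguments `A` are arbitrary.
  obtain ⟨a, ha, -⟩ := hX.exists_color_ne_ne hM hE hc A A
  obtain ⟨B, hB⟩ := hM.exists_sep (fun x => x ≠ a ∧ ∃ u, Maps c u x) A
  obtain ⟨d, hd⟩ := hX.exists_coloring_omit_color hM hE hc hB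
  exact ⟨B, d, hd, fun x hx => ((hB x).1 hx).1, hX.not_cardLE_of_omit_color hM hE hc ha hB⟩

end Coloring

end IsRussellSet

theorem IsModelZF.cardLE_of_sub (hM : IsModelZF M) {A B : M} (h : Sub B A) : CardLE B A := by
  obtain ⟨f, hf, hfR⟩ := hM.exists_function (fun x y => x = y) B A
    fun x hx => ⟨x, ⟨h x hx, rfl⟩, fun y hy => hy.2.symm⟩
  refine ⟨f, hf, fun x x' y hx hx' => ?_⟩
  exact ((hfR x y).1 hx).2.2.trans ((hfR x' y).1 hx').2.2.symm

/-- The inverse bijection; it turns the failure of `CardLE A B` into strictness. -/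
theorem IsModelZF.cardLE_of_cardEq (hM : IsModelZF M) {A B : M} (h : CardEq B A) :
    CardLE A B := by
  obtain ⟨f, hf, hinj, hsurj⟩ := h
  obtain ⟨g, hg, hgR⟩ := hM.exists_function (fun y x => Maps f x y) A B (by
    intro y hy
    obtain ⟨x, hx⟩ := hsurj y hy
    exact ⟨x, ⟨(hf.mem_of_maps hx).1, hx⟩, fun z hz => hinj _ _ _ hz.2 hx⟩)
  refine ⟨g, hg, fun y y' x hy hy' => ?_⟩
  exact hf.unique ((hgR y x).1 hy).2.2 ((hgR y' x).1 hy').2.2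

end ZFModel

open ZFModel in
theorem mainTheorem12 {M : Type*} [setLang.Structure M] (hM : IsModelZF M)
    (X P E : M) (hX : IsRussellSet X P) (hE : IsSetOfTerms E P) :
    (¬ ∃ A, IsChromaticNumber X E A) ∧
      ∀ A c, IsProperColoring X E A c →
        ∃ B d, IsProperColoring X E B d ∧ CardLT B A := by
  constructor
  · rintro ⟨A, ⟨c, hc⟩, hmin⟩
    obtain ⟨B, d, hd, -, hAB⟩ := hX.exists_smaller_coloring hM hE hc
    exact hAB (hmin B ⟨d, hd⟩)
  · intro A c hc
    obtain ⟨B, d, hd, hBA, hAB⟩ := hX.exists_smaller_coloring hM hE hc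
    exact ⟨B, d, hd, hM.cardLE_of_sub hBA, fun h => hAB (hM.cardLE_of_cardEq h)⟩
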